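/- For $\varepsilon>0$ let $u=u_\varepsilon$ be a solution (it is unique) of Lagerstrom's problem with $k=0$, $n=3$, $$u''+\frac{2}{r}u'+\varepsilon u u'=0\quad(1<r<\infty),\qquad u(1)=0,\quad u(\infty)=1,$$ twice differentiable for $r>1$ and continuous for $r\ge 1$. Put $E_m(\rho)=\int_\rho^\infty \tau^{-m}e^{-\tau}\,d\tau$ for $\rho>0$ and let $\gamma$ be Euler's constant. For all sufficiently small $\varepsilon>0$ the function $1-u$ is integrable on $(1,\infty)$ and there is a constant $C=C(\varepsilon)$ with $$r^2u'(r)=C\exp\Big(-\varepsilon r-\varepsilon\int_r^\infty(1-u(t))\,dt\Big)\qquad (r>1).$$ As $\varepsilon\to0^+$ the following hold. 1. $C=1-2\varepsilon\log\varepsilon-\varepsilon(2\gamma+1)+O(\varepsilon^2\log^2\varepsilon)$. 2. (Inner expansion.) For each fixed $r\ge1$, $$u(r)=1-\frac1r-\varepsilon\log\varepsilon\Big(1-\frac1r\Big)-\varepsilon\Big(\log r+\frac{\log r}{r}\Big)+\varepsilon(1-\gamma)\Big(1-\frac1r\Big)+O(\varepsilon^2\log^2\varepsilon).$$ 3. (Outer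 expansion.) For each fixed $\rho>0$, at $r=\rho/\varepsilon$, $$u-1=-C\varepsilon E_2(\rho)+(C\varepsilon)^2\Big\{E_1(\rho)E_2(\rho)-\rho E_2(\rho)^2-\int_\rho^\infty E_2(\tau)^2\,d\tau\Big\}+O(\varepsilon^3),$$ and, with the expansion of $C$ inserted, $$u-1=-\varepsilon\big(1-2\varepsilon\log\varepsilon-\varepsilon(2\gamma+1)\big)E_2(\rho)+\varepsilon^2\Big\{E_1(\rho)E_2(\rho)-\rho E_2(\rho)^2-\int_\rho^\infty E_2(\tau)^2\,d\tau\Big\}+O(\varepsilon^3\log^2\varepsilon).$$ The constants implied in the $O$-terms are absolute in 1, depend only on $r$ in 2, and only on $\rho$ in 3. -/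

import Mathlib

/-- `u` is a (classical) solution of Lagerstrom's boundary value problem
`u'' + ((n - 1) / r) u' + ε u u' + k u' ^ 2 = 0` for `1 < r < ∞`, `u 1 = 0`, `u ∞ = 1`. -/
structure IsLagerstromSolution (n k ε : ℝ) (u : ℝ → ℝ) : Prop where
  continuousOn : ContinuousOn u (Set.Ici 1)
  differentiableAt : ∀ r : ℝ, 1 < r → DifferentiableAt ℝ u r
  differentiableAt_deriv : ∀ r : ℝ, 1 < r → DifferentiableAt ℝ (deriv u) r
  ode : ∀ r : ℝ, 1 < r →
    deriv (deriv u) r + (n - 1) / r * deriv u r + ε * u r * deriv u r + k * (deriv u r) ^ 2 = 0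
  boundary_one : u 1 = 0
  boundary_infty : Filter.Tendsto u Filter.atTop (nhds 1)

/-- For `n = 3`, `k = 0`: `C` is the constant of the first integral
`r ^ 2 u'(r) = C exp (-ε r - ε ∫_r^∞ (1 - u(t)) dt)`, `r > 1`, of the equation, where
`1 - u` is integrable at infinity. -/
def IsLagerstromConstant (ε : ℝ) (u : ℝ → ℝ) (C : ℝ) : Prop :=
  MeasureTheory.IntegrableOn (fun t : ℝ => 1 - u t) (Set.Ioi 1) ∧
    ∀ r : ℝ, 1 < r →
      r ^ 2 * deriv u r = C * Real.exp (-ε * r - ε * ∫ t in Set.Ioi r, (1 - u t))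

/-- The exponential integral `E_m(ρ) = ∫_ρ^∞ τ ^ (-m) e ^ (-τ) dτ`, `ρ > 0`. -/
noncomputable def expIntegralE (m : ℕ) (ρ : ℝ) : ℝ :=
  ∫ τ in Set.Ioi ρ, Real.exp (-τ) / τ ^ m

/-- The second order coefficient of the outer expansion:
`E₁(ρ) E₂(ρ) - ρ E₂(ρ) ^ 2 - ∫_ρ^∞ E₂(τ) ^ 2 dτ`. -/
noncomputable def outerSecond (ρ : ℝ) : ℝ :=
  expIntegralE 1 ρ * expIntegralE 2 ρ - ρ * expIntegralE 2 ρ ^ 2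
    - ∫ τ in Set.Ioi ρ, expIntegralE 2 τ ^ 2

/-! The factor `r ^ 2 * exp (ε ∫ u)` integrates the equation once, so `u` is increasing with values
in `[0, 1]`. In the outer variable `ρ = ε r`, with `v = 1 - u`, tail `V = ∫_ρ^∞ v` and `c = C ε`,
the problem becomes `v' = -c e^{-ρ} ρ^{-2} e^{-V}`, `V' = -v`, with `v` and `V` vanishing at
infinity (`OuterSystem`). Starting from `V ≥ 0`, alternate upper and lower bounds for `v` and `V`
follow by comparing derivatives, and they give `v = c E₂ - c² outerSecond` with error at most `c³ J²
E₂`, where `J = tailE` is the tail integral of `E₂` (`OuterSystem.abs_sub_le`).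

This bound holds on all of `[ε, ∞)`, so no matching is needed. At fixed `ρ` it is the outer
expansion. At `ρ = ε r` the error is `O(ε² log² ε)`, and `E₁(x) = -log x - γ + O(x)` turns it into
the inner expansion; the case `r = 1`, where `v = 1`, is an equation for `C`.

What remains is a bound on `C` uniform in `ε` (`exists_constant`): crude decay of `1 - u` is
bootstrapped to exponential decay at rate `ε / 2`, which bounds `ε ∫ (1 - u)`. -/

namespace Lagerstrom

open MeasureTheory Set Filter Topology Real

/-! ### Tail integrals and comparison from infinity -/

section Tails

variable {f : ℝ → ℝ} {a r : ℝ}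

theorem hasDerivAt_integral_Ioi (hf : IntegrableOn f (Ioi a)) (hc : ContinuousOn f (Ioi a))
    (hr : a < r) : HasDerivAt (fun x => ∫ t in Ioi x, f t) (-f r) r := by
  have hint : IntervalIntegrable f volume a r :=
    (intervalIntegrable_iff_integrableOn_Ioc_of_le hr.le).2 (hf.mono_set Ioc_subset_Ioi_self)
  have h := intervalIntegral.integral_hasDerivAt_right hint
    (hc.stronglyMeasurableAtFilter isOpen_Ioi r hr) (hc.continuousAt (Ioi_mem_nhds hr))
  refine (h.const_sub (∫ t in Ioi a, f t)).congr_of_eventuallyEq ?_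
  filter_upwards [Ioi_mem_nhds hr] with x hx
  rw [← intervalIntegral.integral_Ioi_sub_Ioi hf (le_of_lt hx)]
  ring

theorem tendsto_integral_Ioi_zero (hf : IntegrableOn f (Ioi a)) :
    Tendsto (fun x => ∫ t in Ioi x, f t) atTop (𝓝 0) := by
  have h := intervalIntegral_tendsto_integral_Ioi a hf tendsto_id
  have h2 := h.const_sub (∫ t in Ioi a, f t)
  rw [sub_self] at h2
  refine h2.congr' ?_
  filter_upwards [Ici_mem_atTop a] with x hx
  rw [id, ← intervalIntegral.integral_Ioi_sub_Ioi hf hx]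
  ring

/-- A function on `[a, ∞)` that decreases to `0` is nonnegative. -/
theorem nonneg_of_hasDerivAt_nonpos {f' : ℝ → ℝ} (hc : ContinuousOn f (Ici a))
    (hd : ∀ x, a < x → HasDerivAt f (f' x) x) (hf' : ∀ x, a < x → f' x ≤ 0)
    (hlim : Tendsto f atTop (𝓝 0)) (hr : a ≤ r) : 0 ≤ f r := by
  have hanti : AntitoneOn f (Ici a) := by
    refine antitoneOn_of_deriv_nonpos (convex_Ici a) hc ?_ ?_
    · intro x hx
      rw [interior_Ici] at hx
      exact (hd x hx).differentiableAt.differentiableWithinAt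
    · intro x hx
      rw [interior_Ici] at hx
      rw [(hd x hx).deriv]
      exact hf' x hx
  refine le_of_tendsto hlim ?_
  filter_upwards [Ici_mem_atTop r] with x hx
  exact hanti hr (hr.trans hx) hx

end Tails

/-! ### Exponential integrals and the second-order coefficient -/

section ExpIntegral

variable {x : ℝ} (m : ℕ)

theorem continuousOn_exp_neg_div_pow :
    ContinuousOn (fun t : ℝ => exp (-t) / t ^ m) (Ioi 0) :=
  ContinuousOn.div (by fun_prop) (by fun_prop) fun t ht => pow_ne_zero _ (ne_of_gt ht)

theorem integrableOn_exp_neg_div_pow (hx : 0 < x) :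
    IntegrableOn (fun t : ℝ => exp (-t) / t ^ m) (Ioi x) := by
  refine Integrable.mono' ((integrableOn_exp_neg_Ioi x).div_const (x ^ m))
    (((continuousOn_exp_neg_div_pow m).mono
      (Ioi_subset_Ioi hx.le)).aestronglyMeasurable measurableSet_Ioi) ?_
  refine (ae_restrict_iff' measurableSet_Ioi).2 (ae_of_all _ fun t ht => ?_)
  have ht' : x < t := ht
  have : 0 < t := hx.trans ht
  rw [Real.norm_of_nonneg (by positivity)]
  gcongr

theorem hasDerivAt_expIntegralE (hx : 0 < x) :
    HasDerivAt (expIntegralE m) (-(exp (-x) / x ^ m)) x :=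
  hasDerivAt_integral_Ioi (integrableOn_exp_neg_div_pow m (half_pos hx))
    ((continuousOn_exp_neg_div_pow m).mono (Ioi_subset_Ioi (half_pos hx).le)) (half_lt_self hx)

theorem tendsto_expIntegralE : Tendsto (expIntegralE m) atTop (𝓝 0) :=
  tendsto_integral_Ioi_zero (integrableOn_exp_neg_div_pow m one_pos)

theorem expIntegralE_nonneg (hx : 0 < x) : 0 ≤ expIntegralE m x :=
  setIntegral_nonneg measurableSet_Ioi fun t ht => by
    have : 0 < t := hx.trans ht
    positivity

theorem expIntegralE_anti {y : ℝ} (hx : 0 < x) (hxy : x ≤ y) :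
    expIntegralE m y ≤ expIntegralE m x := by
  refine setIntegral_mono_set (integrableOn_exp_neg_div_pow m hx) ?_
    (Ioi_subset_Ioi hxy).eventuallyLE
  refine (ae_restrict_iff' measurableSet_Ioi).2 (ae_of_all _ fun t ht => ?_)
  have : 0 < t := hx.trans ht
  simp only [Pi.zero_apply]
  positivity

theorem hasDerivAt_exp_neg : HasDerivAt (fun t : ℝ => exp (-t)) (-exp (-x)) x := by
  simpa using (hasDerivAt_neg x).exp

theorem tendsto_exp_neg_atTop : Tendsto (fun t : ℝ => exp (-t)) atTop (𝓝 0) :=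
  tendsto_exp_neg_atTop_nhds_zero

theorem tendsto_exp_neg_div_atTop : Tendsto (fun t : ℝ => exp (-t) / t) atTop (𝓝 0) := by
  simpa [div_eq_mul_inv] using tendsto_exp_neg_atTop.mul tendsto_inv_atTop_zero

/-- Integration by parts. It reduces every later identity to algebra in `E₁` and exponentials. -/
theorem expIntegralE_two (hx : 0 < x) :
    expIntegralE 2 x = exp (-x) / x - expIntegralE 1 x := by
  have h := integral_Ioi_of_hasDerivAt_of_nonneg' (a := x) (l := 0)
    (g := fun t => expIntegralE 1 t - exp (-t) / t) (g' := fun t => exp (-t) / t ^ 2) ?_ ?_ ?_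
  · rw [expIntegralE, h]; ring
  · intro t ht
    have ht0 : 0 < t := hx.trans_le ht
    refine ((hasDerivAt_expIntegralE 1 ht0).sub
      (hasDerivAt_exp_neg.div (hasDerivAt_id t) ht0.ne')).congr_deriv ?_
    simp only [id]
    field_simp
    ring
  · intro t ht
    positivity
  · simpa using (tendsto_expIntegralE 1).sub tendsto_exp_neg_div_atTop

/-- `∫_ρ^∞ E₂` in terms of `E₁`. -/
noncomputable def tailE (ρ : ℝ) : ℝ := (1 + ρ) * expIntegralE 1 ρ - exp (-ρ)

theorem tailE_eq (hx : 0 < x) : tailE x = expIntegralE 1 x - x * expIntegralE 2 x := by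
  rw [expIntegralE_two hx, tailE]
  field_simp
  ring

theorem hasDerivAt_tailE (hx : 0 < x) : HasDerivAt tailE (-expIntegralE 2 x) x := by
  have h := (((hasDerivAt_id x).const_add 1).mul (hasDerivAt_expIntegralE 1 hx)).sub
    (hasDerivAt_exp_neg (x := x))
  refine h.congr_deriv ?_
  rw [expIntegralE_two hx]
  simp only [id]
  field_simp
  ring

theorem mul_expIntegralE_two_le (hx : 0 < x) : x * expIntegralE 2 x ≤ exp (-x) := by
  rw [expIntegralE_two hx, mul_sub, mul_div_cancel₀ _ hx.ne']
  have := mul_nonneg hx.le (expIntegralE_nonneg 1 hx)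
  linarith

theorem tendsto_mul_expIntegralE_two :
    Tendsto (fun x => x * expIntegralE 2 x) atTop (𝓝 0) := by
  refine tendsto_of_tendsto_of_tendsto_of_le_of_le' tendsto_const_nhds tendsto_exp_neg_atTop ?_ ?_
  · filter_upwards [Ioi_mem_atTop 0] with x hx
    exact mul_nonneg (le_of_lt hx) (expIntegralE_nonneg 2 hx)
  · filter_upwards [Ioi_mem_atTop 0] with x hx
    exact mul_expIntegralE_two_le hx

theorem tendsto_tailE : Tendsto tailE atTop (𝓝 0) := by
  have h := (tendsto_expIntegralE 1).sub tendsto_mul_expIntegralE_two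
  rw [sub_zero] at h
  refine h.congr' ?_
  filter_upwards [Ioi_mem_atTop 0] with x hx
  rw [tailE_eq hx]

theorem tailE_nonneg (hx : 0 < x) : 0 ≤ tailE x :=
  nonneg_of_hasDerivAt_nonpos
    (fun _ hy => (hasDerivAt_tailE (hx.trans_le hy)).continuousAt.continuousWithinAt)
    (fun _ hy => hasDerivAt_tailE (hx.trans hy))
    (fun _ hy => neg_nonpos.2 (expIntegralE_nonneg 2 (hx.trans hy))) tendsto_tailE le_rfl

theorem tailE_le (hx : 0 < x) : tailE x ≤ expIntegralE 1 x := by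
  rw [tailE_eq hx]
  have := mul_nonneg hx.le (expIntegralE_nonneg 2 hx)
  linarith

theorem hasDerivAt_expIntegralE_two_mul (hx : 0 < x) :
    HasDerivAt (fun t => expIntegralE m (2 * t)) (-(exp (-(2 * x)) / (2 * x) ^ m) * 2) x := by
  have h1 : HasDerivAt (fun t : ℝ => 2 * t) 2 x := by
    simpa using (hasDerivAt_id x).const_mul 2
  exact (hasDerivAt_expIntegralE m (x := 2 * x) (by positivity)).comp x h1

theorem tendsto_two_mul_atTop : Tendsto (fun t : ℝ => 2 * t) atTop atTop :=
  tendsto_id.const_mul_atTop two_pos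

/-- The function `t E₂² + E₁² - 4 E₂(2t)` is an antiderivative of `E₂²`: the cross terms cancel
because `E₁ + E₂ = e^{-t} / t`. -/
theorem integral_expIntegralE_two_sq (hx : 0 < x) :
    ∫ t in Ioi x, expIntegralE 2 t ^ 2 =
      4 * expIntegralE 2 (2 * x) - expIntegralE 1 x ^ 2 - x * expIntegralE 2 x ^ 2 := by
  have h := integral_Ioi_of_hasDerivAt_of_nonneg' (a := x) (l := 0)
    (g := fun t => t * expIntegralE 2 t * expIntegralE 2 t + expIntegralE 1 t ^ 2
      - 4 * expIntegralE 2 (2 * t)) (g' := fun t => expIntegralE 2 t ^ 2) ?_ ?_ ?_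
  · rw [h]; ring
  · intro t ht
    have ht0 : 0 < t := hx.trans_le ht
    have h1 := hasDerivAt_expIntegralE 1 ht0
    have h2 := hasDerivAt_expIntegralE 2 ht0
    have h3 := hasDerivAt_expIntegralE_two_mul 2 ht0
    refine (((((hasDerivAt_id t).mul h2).mul h2).add (h1.pow 2)).sub
      (h3.const_mul 4)).congr_deriv ?_
    have h5 : exp (-(2 * t)) = exp (-t) ^ 2 := by rw [← exp_nat_mul]; congr 1; push_cast; ring
    rw [h5, expIntegralE_two ht0]
    simp only [id, Pi.mul_apply]
    rw [expIntegralE_two ht0]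
    field_simp
    ring
  · intro t ht
    positivity
  · have h1 := tendsto_mul_expIntegralE_two.mul (tendsto_expIntegralE 2)
    have h2 := (tendsto_expIntegralE 1).pow 2
    have h3 := ((tendsto_expIntegralE 2).comp tendsto_two_mul_atTop).const_mul 4
    simpa using (h1.add h2).sub h3

theorem outerSecond_eq (hx : 0 < x) :
    outerSecond x = exp (-x) / x * expIntegralE 1 x - 2 * exp (-(2 * x)) / x
      + 4 * expIntegralE 1 (2 * x) := by
  rw [outerSecond, integral_expIntegralE_two_sq hx, expIntegralE_two hx,
    expIntegralE_two (x := 2 * x) (by positivity)]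
  field_simp
  ring

/-- Together with decay at infinity this identifies `outerSecond` as `∫_x^∞ e^{-t} t^{-2} tailE t
dt`, the correction produced by replacing `e^{-V}` with `1 - V` and `V` with its leading term. -/
theorem hasDerivAt_outerSecond (hx : 0 < x) :
    HasDerivAt outerSecond (-(exp (-x) / x ^ 2 * tailE x)) x := by
  have h1 := hasDerivAt_expIntegralE 1 hx
  have h3 := hasDerivAt_expIntegralE_two_mul 1 hx
  have h4 : HasDerivAt (fun t : ℝ => exp (-(2 * t))) (-exp (-(2 * x)) * 2) x :=
    (hasDerivAt_exp_neg (x := 2 * x)).comp x (by simpa using (hasDerivAt_id x).const_mul 2)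
  have h2 := (hasDerivAt_exp_neg (x := x)).div (hasDerivAt_id x) hx.ne'
  have h := ((h2.mul h1).sub ((h4.const_mul 2).div (hasDerivAt_id x) hx.ne')).add (h3.const_mul 4)
  refine (h.congr_of_eventuallyEq ?_).congr_deriv ?_
  · filter_upwards [Ioi_mem_nhds hx] with t ht
    rw [outerSecond_eq ht]
    rfl
  · have h5 : exp (-(2 * x)) = exp (-x) ^ 2 := by rw [← exp_nat_mul]; congr 1; push_cast; ring
    rw [h5, tailE]
    simp only [id, Pi.div_apply]
    field_simp
    ring

theorem tendsto_outerSecond : Tendsto outerSecond atTop (𝓝 0) := by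
  have h1 := tendsto_exp_neg_div_atTop.mul (tendsto_expIntegralE 1)
  have h2 := ((tendsto_exp_neg_div_atTop.comp tendsto_two_mul_atTop).const_mul 4)
  have h3 := ((tendsto_expIntegralE 1).comp tendsto_two_mul_atTop).const_mul 4
  have h := (h1.sub h2).add h3
  simp only [mul_zero, sub_zero, add_zero] at h
  refine h.congr' ?_
  filter_upwards [Ioi_mem_atTop 0] with x hx
  have hx' : 0 < x := hx
  rw [outerSecond_eq hx]
  simp only [Function.comp]
  field_simp
  ring

theorem outerSecond_le (hx : 0 < x) : outerSecond x ≤ tailE x * expIntegralE 2 x := by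
  rw [outerSecond, tailE_eq hx]
  have : 0 ≤ ∫ t in Ioi x, expIntegralE 2 t ^ 2 := integral_nonneg fun t => by positivity
  linarith

end ExpIntegral

/-! ### Euler's constant and `E₁` near zero -/

section Euler

theorem integrableOn_log_mul_exp_neg :
    IntegrableOn (fun t : ℝ => log t * exp (-t)) (Ioi 0) := by
  have hm : AEStronglyMeasurable (fun t : ℝ => log t * exp (-t)) volume :=
    (by fun_prop : Measurable fun t : ℝ => log t * exp (-t)).aestronglyMeasurable
  rw [← Ioc_union_Ioi_eq_Ioi (zero_le_one (α := ℝ)), integrableOn_union]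
  constructor
  · have h := (intervalIntegrable_iff_integrableOn_Ioc_of_le zero_le_one).1
      (intervalIntegral.intervalIntegrable_log' (a := 0) (b := 1))
    refine Integrable.mono' h.norm hm.restrict ?_
    refine (ae_restrict_iff' measurableSet_Ioc).2 (ae_of_all _ fun t ht => ?_)
    rw [norm_mul, Real.norm_of_nonneg (exp_pos _).le]
    exact mul_le_of_le_one_right (norm_nonneg _) (exp_le_one_iff.2 (by linarith [ht.1]))
  · have h := (Real.GammaIntegral_convergent (s := 2) two_pos).mono_set
      (Ioi_subset_Ioi (zero_le_one (α := ℝ)))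
    refine Integrable.mono' h hm.restrict ?_
    refine (ae_restrict_iff' measurableSet_Ioi).2 (ae_of_all _ fun t ht => ?_)
    have ht' : 1 < t := ht
    rw [Real.norm_of_nonneg (mul_nonneg (log_nonneg ht'.le) (exp_pos _).le), mul_comm]
    have e : (2 : ℝ) - 1 = 1 := by norm_num
    rw [e, rpow_one]
    have := log_le_sub_one_of_pos (zero_lt_one.trans ht')
    gcongr
    linarith

/-- Both sides are `Γ'(1)`: the left one by differentiating the Gamma integral under the integral
sign. -/
theorem integral_log_mul_exp_neg :
    ∫ t in Ioi (0 : ℝ), log t * exp (-t) = -eulerMascheroniConstant := by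
  have h1 := Complex.hasDerivAt_GammaIntegral (s := 1) (by simp)
  have h2 : HasDerivAt Complex.GammaIntegral (-(eulerMascheroniConstant : ℂ)) 1 := by
    refine Complex.hasDerivAt_Gamma_one.congr_of_eventuallyEq ?_
    have : ∀ᶠ s : ℂ in 𝓝 1, 0 < s.re :=
      (Complex.continuous_re.tendsto 1).eventually (lt_mem_nhds (by simp))
    filter_upwards [this] with s hs
    rw [Complex.Gamma_eq_integral hs]
  have h3 := h1.unique h2
  simp only [sub_self, Complex.cpow_zero, one_mul] at h3
  have h4 : ∫ t in Ioi (0 : ℝ), (↑(log t) * ↑(exp (-t)) : ℂ)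
      = ((∫ t in Ioi (0 : ℝ), log t * exp (-t) : ℝ) : ℂ) := by
    rw [← integral_complex_ofReal]
    simp
  rw [h4] at h3
  exact_mod_cast h3

variable {x : ℝ}

theorem integral_Ioi_log_mul_exp_neg (hx : 0 < x) :
    ∫ t in Ioi x, log t * exp (-t) = expIntegralE 1 x + exp (-x) * log x := by
  have hd : ∀ t ∈ Ici x, HasDerivAt (fun t => -exp (-t) * log t - expIntegralE 1 t)
      (log t * exp (-t)) t := by
    intro t ht
    have ht0 : 0 < t := hx.trans_le ht
    refine ((hasDerivAt_exp_neg.neg.mul (hasDerivAt_log ht0.ne')).sub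
      (hasDerivAt_expIntegralE 1 ht0)).congr_deriv ?_
    field_simp
    simp
  have hlim : Tendsto (fun t => -exp (-t) * log t - expIntegralE 1 t) atTop (𝓝 0) := by
    have h1 : Tendsto (fun t : ℝ => exp (-t) * log t) atTop (𝓝 0) := by
      have h2 := tendsto_pow_mul_exp_neg_atTop_nhds_zero 1
      refine tendsto_of_tendsto_of_tendsto_of_le_of_le' tendsto_const_nhds h2 ?_ ?_
      · filter_upwards [Ici_mem_atTop 1] with t ht
        exact mul_nonneg (exp_pos _).le (log_nonneg ht)
      · filter_upwards [Ici_mem_atTop 1] with t ht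
        have ht' : (1 : ℝ) ≤ t := ht
        rw [mul_comm, pow_one]
        have := log_le_sub_one_of_pos (zero_lt_one.trans_le ht')
        gcongr
        linarith
    simpa using h1.neg.sub (tendsto_expIntegralE 1)
  rw [integral_Ioi_of_hasDerivAt_of_tendsto' hd
    (integrableOn_log_mul_exp_neg.mono_set (Ioi_subset_Ioi hx.le)) hlim]
  ring

/-- By parts, `E₁(x) + log x = ∫_x^∞ log t e^{-t} dt + (1 - e^{-x}) log x`, and the last term is at
most `x |log x|` in absolute value. -/
theorem tendsto_expIntegralE_one_add_log :
    Tendsto (fun x => expIntegralE 1 x + log x) (𝓝[>] 0) (𝓝 (-eulerMascheroniConstant)) := by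
  have h1 := (integrableOn_log_mul_exp_neg.continuousOn_Ici_primitive_Ioi 0 self_mem_Ici).mono
    Ioi_subset_Ici_self
  rw [ContinuousWithinAt, integral_log_mul_exp_neg] at h1
  have h2 : Tendsto (fun x : ℝ => (1 - exp (-x)) * log x) (𝓝[>] 0) (𝓝 0) := by
    have h3 : Tendsto (fun x : ℝ => log x * x) (𝓝[>] 0) (𝓝 0) := by
      simpa using tendsto_log_mul_rpow_nhdsGT_zero one_pos
    refine squeeze_zero_norm' ?_ (tendsto_zero_iff_norm_tendsto_zero.1 h3)
    filter_upwards [self_mem_nhdsWithin] with x hx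
    have hx' : 0 < x := hx
    rw [norm_mul, norm_mul, mul_comm]
    gcongr
    have h5 := add_one_le_exp (-x)
    have h6 : exp (-x) ≤ 1 := exp_le_one_iff.2 (by linarith)
    rw [Real.norm_of_nonneg (by linarith), Real.norm_of_nonneg hx'.le]
    linarith
  have h := h1.add h2
  rw [add_zero] at h
  refine h.congr' ?_
  filter_upwards [self_mem_nhdsWithin] with x hx
  rw [integral_Ioi_log_mul_exp_neg hx]
  ring

theorem hasDerivAt_expIntegralE_one_add_log (hx : 0 < x) :
    HasDerivAt (fun x => expIntegralE 1 x + log x) ((1 - exp (-x)) / x) x := by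
  refine ((hasDerivAt_expIntegralE 1 hx).add (hasDerivAt_log hx.ne')).congr_deriv ?_
  field_simp
  ring

theorem neg_eulerMascheroniConstant_le (hx : 0 < x) :
    -eulerMascheroniConstant ≤ expIntegralE 1 x + log x := by
  have hmono : MonotoneOn (fun x => expIntegralE 1 x + log x) (Ioi 0) := by
    refine monotoneOn_of_deriv_nonneg (convex_Ioi 0) ?_ ?_ ?_
    · exact fun t ht =>
        (hasDerivAt_expIntegralE_one_add_log ht).continuousAt.continuousWithinAt
    · rw [interior_Ioi]
      exact fun t ht =>
        (hasDerivAt_expIntegralE_one_add_log ht).differentiableAt.differentiableWithinAt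
    · rw [interior_Ioi]
      intro t ht
      have ht' : 0 < t := ht
      rw [(hasDerivAt_expIntegralE_one_add_log ht).deriv]
      have h6 : exp (-t) ≤ 1 := exp_le_one_iff.2 (by linarith)
      exact div_nonneg (by linarith) ht'.le
  refine le_of_tendsto tendsto_expIntegralE_one_add_log ?_
  filter_upwards [Ioo_mem_nhdsGT hx] with y hy
  exact hmono hy.1 hx hy.2.le

/-- The derivative `(1 - e^{-t}) / t` of `E₁ + log` is at most `1`, and the limit at `0` is `-γ`. -/
theorem expIntegralE_one_add_log_le (hx : 0 < x) :
    expIntegralE 1 x + log x ≤ -eulerMascheroniConstant + x := by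
  have hd : ∀ t, 0 < t → HasDerivAt (fun x => expIntegralE 1 x + log x - x)
      ((1 - exp (-t)) / t - 1) t := fun t ht =>
    (hasDerivAt_expIntegralE_one_add_log ht).sub (hasDerivAt_id t)
  have hanti : AntitoneOn (fun x => expIntegralE 1 x + log x - x) (Ioi 0) := by
    refine antitoneOn_of_deriv_nonpos (convex_Ioi 0) ?_ ?_ ?_
    · exact fun t ht => (hd t ht).continuousAt.continuousWithinAt
    · rw [interior_Ioi]
      exact fun t ht => (hd t ht).differentiableAt.differentiableWithinAt
    · rw [interior_Ioi]
      intro t ht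
      have ht' : 0 < t := ht
      rw [(hd t ht).deriv, sub_nonpos, div_le_one ht']
      have h5 := add_one_le_exp (-t)
      linarith
  have hlim : Tendsto (fun x => expIntegralE 1 x + log x - x) (𝓝[>] 0)
      (𝓝 (-eulerMascheroniConstant - 0)) :=
    tendsto_expIntegralE_one_add_log.sub (tendsto_id.mono_left nhdsWithin_le_nhds)
  have h : expIntegralE 1 x + log x - x ≤ -eulerMascheroniConstant - 0 := by
    refine ge_of_tendsto hlim ?_
    filter_upwards [Ioo_mem_nhdsGT hx] with y hy
    exact hanti hy.1 hx hy.2.le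
  linarith

end Euler

/-! ### Alternating bounds for the outer system -/

section Comparison

variable {a c x : ℝ} {v V : ℝ → ℝ}

/-- The first integral of Lagerstrom's equation (`k = 0`, `n = 3`) in the outer variable `ρ = ε r`:
`v = 1 - u`, `V` is the tail integral of `v`, and `c = C ε`. -/
structure OuterSystem (a c : ℝ) (v V : ℝ → ℝ) : Prop where
  pos : 0 < a
  const_nonneg : 0 ≤ c
  continuousOn : ContinuousOn v (Ici a)
  continuousOn_tail : ContinuousOn V (Ici a)
  hasDerivAt : ∀ x, a < x → HasDerivAt v (-(c * (exp (-x) / x ^ 2 * exp (-V x)))) x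
  hasDerivAt_tail : ∀ x, a < x → HasDerivAt V (-v x) x
  tendsto : Tendsto v atTop (𝓝 0)
  tendsto_tail : Tendsto V atTop (𝓝 0)

namespace OuterSystem

theorem continuousOn_expIntegralE (m : ℕ) (ha : 0 < a) :
    ContinuousOn (expIntegralE m) (Ici a) := fun _ hx =>
  (hasDerivAt_expIntegralE m (ha.trans_le hx)).continuousAt.continuousWithinAt

theorem continuousOn_tailE (ha : 0 < a) : ContinuousOn tailE (Ici a) := fun _ hx =>
  (hasDerivAt_tailE (ha.trans_le hx)).continuousAt.continuousWithinAt

theorem continuousOn_outerSecond (ha : 0 < a) : ContinuousOn outerSecond (Ici a) := fun _ hx =>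
  (hasDerivAt_outerSecond (ha.trans_le hx)).continuousAt.continuousWithinAt

theorem weight_nonneg (h : OuterSystem a c v V) (x : ℝ) : 0 ≤ c * (exp (-x) / x ^ 2) :=
  mul_nonneg h.const_nonneg (by positivity)

theorem v_nonneg (h : OuterSystem a c v V) (hx : a ≤ x) : 0 ≤ v x :=
  nonneg_of_hasDerivAt_nonpos h.continuousOn h.hasDerivAt
    (fun y _ => by
      rw [← mul_assoc]
      exact neg_nonpos.2 (mul_nonneg (h.weight_nonneg y) (exp_pos _).le)) h.tendsto hx

theorem tail_nonneg (h : OuterSystem a c v V) (hx : a ≤ x) : 0 ≤ V x :=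
  nonneg_of_hasDerivAt_nonpos h.continuousOn_tail h.hasDerivAt_tail
    (fun _ hy => neg_nonpos.2 (h.v_nonneg (le_of_lt hy))) h.tendsto_tail hx

theorem v_le (h : OuterSystem a c v V) (hx : a ≤ x) : v x ≤ c * expIntegralE 2 x := by
  refine sub_nonneg.1 (nonneg_of_hasDerivAt_nonpos (f := fun x => c * expIntegralE 2 x - v x)
    (((continuousOn_expIntegralE 2 h.pos).const_mul c).sub h.continuousOn)
    (fun y hy => ((hasDerivAt_expIntegralE 2 (h.pos.trans hy)).const_mul c).sub
      (h.hasDerivAt y hy)) (fun y hy => ?_) ?_ hx)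
  · have h1 : exp (-V y) ≤ 1 := exp_le_one_iff.2 (by linarith [h.tail_nonneg hy.le])
    have h2 := mul_le_mul_of_nonneg_left h1 (h.weight_nonneg y)
    linarith
  · simpa using ((tendsto_expIntegralE 2).const_mul c).sub h.tendsto

theorem tail_le (h : OuterSystem a c v V) (hx : a ≤ x) : V x ≤ c * tailE x := by
  refine sub_nonneg.1 (nonneg_of_hasDerivAt_nonpos (f := fun x => c * tailE x - V x)
    (((continuousOn_tailE h.pos).const_mul c).sub h.continuousOn_tail)
    (fun y hy => ((hasDerivAt_tailE (h.pos.trans hy)).const_mul c).sub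
      (h.hasDerivAt_tail y hy)) (fun y hy => ?_) ?_ hx)
  · have := h.v_le hy.le
    linarith
  · simpa using (tendsto_tailE.const_mul c).sub h.tendsto_tail

/-- Uses `e^{-V} ≥ 1 - V ≥ 1 - c tailE` and integrates from infinity. -/
theorem le_v (h : OuterSystem a c v V) (hx : a ≤ x) :
    c * expIntegralE 2 x - c ^ 2 * outerSecond x ≤ v x := by
  refine sub_nonneg.1 (nonneg_of_hasDerivAt_nonpos
    (f := fun x => v x - (c * expIntegralE 2 x - c ^ 2 * outerSecond x))
    (h.continuousOn.sub (((continuousOn_expIntegralE 2 h.pos).const_mul c).sub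
      ((continuousOn_outerSecond h.pos).const_mul _)))
    (fun y hy => (h.hasDerivAt y hy).sub
      (((hasDerivAt_expIntegralE 2 (h.pos.trans hy)).const_mul c).sub
        ((hasDerivAt_outerSecond (h.pos.trans hy)).const_mul _))) (fun y hy => ?_) ?_ hx)
  · have h1 : 1 - c * tailE y ≤ exp (-V y) := by
      linarith [h.tail_le hy.le, add_one_le_exp (-V y)]
    have h2 := mul_le_mul_of_nonneg_left h1 (h.weight_nonneg y)
    nlinarith
  · simpa using h.tendsto.sub
      (((tendsto_expIntegralE 2).const_mul c).sub (tendsto_outerSecond.const_mul (c ^ 2)))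

/-- Integrating the lower bound for `v` needs only `outerSecond ≤ tailE * E₂`, and `tailE * E₂` is
the derivative of `-tailE² / 2`. -/
theorem le_tail (h : OuterSystem a c v V) (hx : a ≤ x) :
    c * tailE x - c ^ 2 * tailE x ^ 2 / 2 ≤ V x := by
  have hd : ∀ y, a < y → HasDerivAt (fun x => V x - (c * tailE x - c ^ 2 * tailE x ^ 2 / 2))
      (-v y + c * expIntegralE 2 y - c ^ 2 * (tailE y * expIntegralE 2 y)) y := by
    intro y hy
    have hJ := hasDerivAt_tailE (h.pos.trans hy)
    refine ((h.hasDerivAt_tail y hy).sub ((hJ.const_mul c).sub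
      (((hJ.pow 2).const_mul (c ^ 2)).div_const 2))).congr_deriv ?_
    push_cast
    ring
  refine sub_nonneg.1 (nonneg_of_hasDerivAt_nonpos
    (f := fun x => V x - (c * tailE x - c ^ 2 * tailE x ^ 2 / 2))
    (h.continuousOn_tail.sub (((continuousOn_tailE h.pos).const_mul c).sub
      ((((continuousOn_tailE h.pos).pow 2).const_mul _).div_const 2))) hd
    (fun y hy => ?_) ?_ hx)
  · have h1 := h.le_v hy.le
    have h2 := mul_le_mul_of_nonneg_left (outerSecond_le (h.pos.trans hy)) (sq_nonneg c)
    linarith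
  · simpa using h.tendsto_tail.sub ((tendsto_tailE.const_mul c).sub
      (((tendsto_tailE.pow 2).const_mul (c ^ 2)).div_const 2))

/-- Follows from `e^y ≥ 1 + y + y²/2` and `(1 - y + y²/2)(1 + y + y²/2) = 1 + y⁴/4 ≥ 1`. -/
theorem _root_.Lagerstrom.exp_neg_le_quadratic {y : ℝ} (hy : 0 ≤ y) :
    exp (-y) ≤ 1 - y + y ^ 2 / 2 := by
  have h := quadratic_le_exp_of_nonneg hy
  have hpos : 0 < 1 - y + y ^ 2 / 2 := by nlinarith [sq_nonneg (y - 1)]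
  rw [exp_neg]
  refine inv_le_of_inv_le₀ hpos (le_trans ?_ h)
  rw [inv_le_comm₀ hpos (by positivity), inv_eq_one_div, div_le_iff₀ (by positivity)]
  nlinarith [sq_nonneg (y ^ 2)]

/-- The two bounds on `V` give `e^{-V} ≤ 1 - c J + c² J²` with `J = tailE`. Instead of integrating
`J² e^{-t} / t²` exactly, the majorant `J² E₂` is used: its derivative contains that term and a
further one, `-2 J E₂²`, of favourable sign. -/
theorem v_le_second (h : OuterSystem a c v V) (hx : a ≤ x) :
    v x ≤ c * expIntegralE 2 x - c ^ 2 * outerSecond x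
      + c ^ 3 * (tailE x ^ 2 * expIntegralE 2 x) := by
  have hd : ∀ y, a < y → HasDerivAt (fun x => c * expIntegralE 2 x - c ^ 2 * outerSecond x
      + c ^ 3 * (tailE x ^ 2 * expIntegralE 2 x) - v x)
      (-(c * (exp (-y) / y ^ 2) * (1 - c * tailE y + c ^ 2 * tailE y ^ 2 - exp (-V y)))
        - 2 * c ^ 3 * (tailE y * expIntegralE 2 y ^ 2)) y := by
    intro y hy
    have hJ := hasDerivAt_tailE (h.pos.trans hy)
    have hE := hasDerivAt_expIntegralE 2 (h.pos.trans hy)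
    refine ((((hE.const_mul c).sub ((hasDerivAt_outerSecond (h.pos.trans hy)).const_mul _)).add
      (((hJ.pow 2).mul hE).const_mul (c ^ 3))).sub (h.hasDerivAt y hy)).congr_deriv ?_
    simp only [Pi.pow_apply]
    push_cast
    ring
  have hE := continuousOn_expIntegralE 2 h.pos
  refine sub_nonneg.1 (nonneg_of_hasDerivAt_nonpos
    (f := fun x => c * expIntegralE 2 x - c ^ 2 * outerSecond x
      + c ^ 3 * (tailE x ^ 2 * expIntegralE 2 x) - v x)
    ((((hE.const_mul c).sub ((continuousOn_outerSecond h.pos).const_mul _)).add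
      ((((continuousOn_tailE h.pos).pow 2).mul hE).const_mul _)).sub h.continuousOn) hd
    (fun y hy => ?_) ?_ hx)
  · have hJ := tailE_nonneg (h.pos.trans hy)
    have hV := h.tail_nonneg hy.le
    have h0 := h.tail_le hy.le
    have h1 : exp (-V y) ≤ 1 - c * tailE y + c ^ 2 * tailE y ^ 2 := by
      have h2 := exp_neg_le_quadratic hV
      have h3 := h.le_tail hy.le
      have h4 : V y ^ 2 ≤ (c * tailE y) ^ 2 := by gcongr
      nlinarith
    have h5 := mul_nonneg (h.weight_nonneg y) (sub_nonneg.2 h1)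
    have h6 : 0 ≤ 2 * c ^ 3 * (tailE y * expIntegralE 2 y ^ 2) := by
      have := h.const_nonneg
      positivity
    linarith
  · simpa using ((((tendsto_expIntegralE 2).const_mul c).sub
      (tendsto_outerSecond.const_mul (c ^ 2))).add
      (((tendsto_tailE.pow 2).mul (tendsto_expIntegralE 2)).const_mul (c ^ 3))).sub h.tendsto

theorem abs_sub_le (h : OuterSystem a c v V) (hx : a ≤ x) :
    |v x - (c * expIntegralE 2 x - c ^ 2 * outerSecond x)|
      ≤ c ^ 3 * (tailE x ^ 2 * expIntegralE 2 x) :=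
  abs_sub_le_iff.2 ⟨by linarith [h.v_le_second hx], by
    have h1 := h.le_v hx
    have h2 : 0 ≤ c ^ 3 * (tailE x ^ 2 * expIntegralE 2 x) := by
      have := h.const_nonneg
      have := expIntegralE_nonneg 2 (h.pos.trans_le hx)
      positivity
    linarith⟩

end OuterSystem

end Comparison

/-! ### First integral and bounds uniform in `ε` -/

section Solution

variable {ε r : ℝ} {u : ℝ → ℝ}

theorem intervalIntegrable_of_solution (h : IsLagerstromSolution 3 0 ε u) {a b : ℝ} (ha : 1 ≤ a)
    (hb : 1 ≤ b) : IntervalIntegrable u volume a b :=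
  (h.continuousOn.mono fun _ ht => (le_min ha hb).trans ht.1).intervalIntegrable

theorem hasDerivAt_primitive (h : IsLagerstromSolution 3 0 ε u) (hr : 1 < r) :
    HasDerivAt (fun x => ∫ t in (1 : ℝ)..x, u t) (u r) r :=
  intervalIntegral.integral_hasDerivAt_right (intervalIntegrable_of_solution h le_rfl hr.le)
    ((h.continuousOn.mono Ioi_subset_Ici_self).stronglyMeasurableAtFilter isOpen_Ioi r hr)
    (h.differentiableAt r hr).continuousAt

theorem exists_first_integral (h : IsLagerstromSolution 3 0 ε u) :
    ∃ A : ℝ, ∀ r, 1 < r → HasDerivAt u (A / r ^ 2 * exp (-ε * ∫ t in (1 : ℝ)..r, u t)) r := by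
  set P : ℝ → ℝ := fun r => r ^ 2 * deriv u r * exp (ε * ∫ t in (1 : ℝ)..r, u t) with hP
  have hd : ∀ r, 1 < r → HasDerivAt P 0 r := by
    intro r hr
    have h0 : r ≠ 0 := by positivity
    have h1 := (((hasDerivAt_id r).pow 2).mul (h.differentiableAt_deriv r hr).hasDerivAt).mul
      (((hasDerivAt_primitive h hr).const_mul ε).exp)
    refine h1.congr_deriv ?_
    have h2 := h.ode r hr
    have h3 : deriv (deriv u) r = -(2 / r * deriv u r + ε * u r * deriv u r) := by
      linear_combination h2
    simp only [id, Pi.pow_apply, Pi.mul_apply, h3]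
    field_simp
    push_cast
    ring
  refine ⟨P 2, fun r hr => ?_⟩
  have hc : P r = P 2 := isOpen_Ioi.is_const_of_deriv_eq_zero (isPreconnected_Ioi (a := (1 : ℝ)))
    (fun x hx => (hd x hx).differentiableAt.differentiableWithinAt)
    (fun x hx => (hd x hx).deriv) hr (by norm_num : (2 : ℝ) ∈ Ioi 1)
  refine (h.differentiableAt r hr).hasDerivAt.congr_deriv ?_
  have h0 : r ≠ 0 := by positivity
  rw [← hc, hP, neg_mul, exp_neg]
  have := exp_ne_zero (ε * ∫ t in (1 : ℝ)..r, u t)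
  field_simp

variable {A : ℝ}

theorem first_integral_pos (h : IsLagerstromSolution 3 0 ε u)
    (hA : ∀ r, 1 < r → HasDerivAt u (A / r ^ 2 * exp (-ε * ∫ t in (1 : ℝ)..r, u t)) r) :
    0 < A := by
  by_contra! hneg
  have hanti : AntitoneOn u (Ici 1) := by
    refine antitoneOn_of_deriv_nonpos (convex_Ici 1) h.continuousOn ?_ ?_
    · rw [interior_Ici]
      exact fun x hx => (hA x hx).differentiableAt.differentiableWithinAt
    · rw [interior_Ici]
      intro x hx
      rw [(hA x hx).deriv]
      exact mul_nonpos_of_nonpos_of_nonneg (div_nonpos_of_nonpos_of_nonneg hneg (sq_nonneg x))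
        (exp_pos _).le
  have : (1 : ℝ) ≤ 0 := by
    refine le_of_tendsto h.boundary_infty ?_
    filter_upwards [Ici_mem_atTop 1] with x hx
    rw [← h.boundary_one]
    exact hanti self_mem_Ici hx hx
  linarith

theorem solution_monotoneOn (h : IsLagerstromSolution 3 0 ε u)
    (hA : ∀ r, 1 < r → HasDerivAt u (A / r ^ 2 * exp (-ε * ∫ t in (1 : ℝ)..r, u t)) r) :
    MonotoneOn u (Ici 1) := by
  have hpos := first_integral_pos h hA
  refine monotoneOn_of_deriv_nonneg (convex_Ici 1) h.continuousOn ?_ ?_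
  · rw [interior_Ici]
    exact fun x hx => (hA x hx).differentiableAt.differentiableWithinAt
  · rw [interior_Ici]
    intro x hx
    rw [(hA x hx).deriv]
    positivity

theorem solution_mem_Icc (h : IsLagerstromSolution 3 0 ε u) (hr : 1 ≤ r) : u r ∈ Icc 0 1 := by
  obtain ⟨A, hA⟩ := exists_first_integral h
  have hmono := solution_monotoneOn h hA
  constructor
  · rw [← h.boundary_one]
    exact hmono self_mem_Ici hr hr
  · refine ge_of_tendsto h.boundary_infty ?_
    filter_upwards [Ici_mem_atTop r] with x hx
    exact hmono hr (hr.trans hx) hx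

theorem primitive_nonneg (h : IsLagerstromSolution 3 0 ε u) (hr : 1 ≤ r) :
    0 ≤ ∫ t in (1 : ℝ)..r, u t :=
  intervalIntegral.integral_nonneg hr fun _ ht => (solution_mem_Icc h ht.1).1

theorem primitive_le (h : IsLagerstromSolution 3 0 ε u) (hr : 1 ≤ r) :
    ∫ t in (1 : ℝ)..r, u t ≤ r - 1 := by
  have := intervalIntegral.integral_mono_on hr (intervalIntegrable_of_solution h le_rfl hr)
    (intervalIntegrable_const (c := (1 : ℝ))) fun t ht => (solution_mem_Icc h ht.1).2
  simpa using this

theorem hasDerivAt_const_div (K : ℝ) (hr : r ≠ 0) :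
    HasDerivAt (fun x => K / x) (-(K / r ^ 2)) r := by
  refine ((hasDerivAt_const r K).div (hasDerivAt_id r) hr).congr_deriv ?_
  simp only [id]
  ring

theorem tendsto_one_sub (h : IsLagerstromSolution 3 0 ε u) :
    Tendsto (fun r => 1 - u r) atTop (𝓝 0) := by
  simpa using h.boundary_infty.const_sub 1

/-- On `[1, 2]` the primitive of `u` is at most `1`, so `u' ≥ A e^{-1} / x²`. Integrating, `A e^{-1}
/ 2 ≤ u 2 ≤ 1`, hence `A ≤ 2e < 6`. -/
theorem first_integral_le (hε1 : ε ≤ 1) (h : IsLagerstromSolution 3 0 ε u)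
    (hA : ∀ r, 1 < r → HasDerivAt u (A / r ^ 2 * exp (-ε * ∫ t in (1 : ℝ)..r, u t)) r) :
    A ≤ 6 := by
  have hpos := first_integral_pos h hA
  have hd : ∀ x, 1 < x → HasDerivAt (fun x => u x + A * exp (-1) / x)
      (A / x ^ 2 * exp (-ε * ∫ t in (1 : ℝ)..x, u t) + -(A * exp (-1) / x ^ 2)) x := fun x hx =>
    (hA x hx).add (hasDerivAt_const_div _ (by positivity))
  have hmono : MonotoneOn (fun x => u x + A * exp (-1) / x) (Icc 1 2) := by
    refine monotoneOn_of_deriv_nonneg (convex_Icc 1 2) ?_ ?_ ?_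
    · refine (h.continuousOn.mono Icc_subset_Ici_self).add
        (continuousOn_const.div continuousOn_id fun x hx => ?_)
      exact (zero_lt_one.trans_le hx.1).ne'
    · rw [interior_Icc]
      exact fun x hx => (hd x hx.1).differentiableAt.differentiableWithinAt
    · rw [interior_Icc]
      intro x hx
      rw [(hd x hx.1).deriv]
      have h1 : exp (-1) ≤ exp (-ε * ∫ t in (1 : ℝ)..x, u t) := by
        have h2 := primitive_nonneg h hx.1.le
        have h3 := primitive_le h hx.1.le
        have h4 : ∫ t in (1 : ℝ)..x, u t ≤ 1 := by linarith [hx.2]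
        rw [exp_le_exp]
        have := mul_le_one₀ hε1 h2 h4
        linarith
      have h2 : A / x ^ 2 * exp (-1) ≤ A / x ^ 2 * exp (-ε * ∫ t in (1 : ℝ)..x, u t) := by
        gcongr
      have h3 : A * exp (-1) / x ^ 2 = A / x ^ 2 * exp (-1) := by ring
      linarith
  have h1 := hmono (by norm_num : (1 : ℝ) ∈ Icc 1 2) (by norm_num : (2 : ℝ) ∈ Icc 1 2) one_le_two
  simp only [h.boundary_one] at h1
  have h2 := (solution_mem_Icc h one_le_two).2
  have h3 : A * exp (-1) ≤ 2 := by linarith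
  rw [exp_neg, ← div_eq_mul_inv, div_le_iff₀ (exp_pos 1)] at h3
  linarith [exp_one_lt_d9]

theorem one_sub_le_div (hε : 0 < ε) (hε1 : ε ≤ 1) (h : IsLagerstromSolution 3 0 ε u)
    (hr : 1 ≤ r) : 1 - u r ≤ 6 / r := by
  obtain ⟨A, hA⟩ := exists_first_integral h
  have hpos := first_integral_pos h hA
  refine sub_nonneg.1 (nonneg_of_hasDerivAt_nonpos (a := 1) (f := fun x => 6 / x - (1 - u x))
    ((continuousOn_const.div continuousOn_id fun x hx => (zero_lt_one.trans_le hx).ne').sub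
      (continuousOn_const.sub h.continuousOn))
    (fun x hx => (hasDerivAt_const_div 6 (by positivity)).sub ((hA x hx).const_sub 1))
    (fun x hx => ?_) ?_ hr)
  · have h1 : exp (-ε * ∫ t in (1 : ℝ)..x, u t) ≤ 1 :=
      exp_le_one_iff.2 (by nlinarith [primitive_nonneg h hx.le])
    have h2 : A / x ^ 2 * exp (-ε * ∫ t in (1 : ℝ)..x, u t) ≤ 6 / x ^ 2 * 1 := by
      have := first_integral_le hε1 h hA
      gcongr
    linarith
  · simpa using (tendsto_const_nhds.div_atTop tendsto_id).sub (tendsto_one_sub h)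

/-- Beyond `r = 12` the bound `1 - u ≤ 6 / r` forces `u ≥ 1 / 2`. -/
theorem le_primitive (hε : 0 < ε) (hε1 : ε ≤ 1) (h : IsLagerstromSolution 3 0 ε u)
    (hr : 1 ≤ r) : (r - 12) / 2 ≤ ∫ t in (1 : ℝ)..r, u t := by
  have h0 := primitive_nonneg h hr
  rcases le_total r 12 with h12 | h12
  · linarith
  · have h1 := intervalIntegral.integral_mono_on h12 (intervalIntegrable_const (c := (1 / 2 : ℝ)))
      (intervalIntegrable_of_solution h (by norm_num) hr) fun t ht => by
        have h2 := one_sub_le_div hε hε1 h (r := t) (by linarith [ht.1])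
        have h3 : 6 / t ≤ 1 / 2 := by
          rw [div_le_iff₀ (by linarith [ht.1])]
          linarith [ht.1]
        show 1 / 2 ≤ u t
        linarith
    have h2 := intervalIntegral.integral_add_adjacent_intervals
      (intervalIntegrable_of_solution h le_rfl (by norm_num : (1 : ℝ) ≤ 12))
      (intervalIntegrable_of_solution h (by norm_num : (1 : ℝ) ≤ 12) hr)
    have h3 := primitive_nonneg h (by norm_num : (1 : ℝ) ≤ 12)
    simp only [intervalIntegral.integral_const, smul_eq_mul] at h1
    linarith

/-- The linear growth of `∫ u` is fed back into the first integral; the factor `e^6` absorbs the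
shift by `12`, as `ε ≤ 1`. -/
theorem one_sub_le_exp (hε : 0 < ε) (hε1 : ε ≤ 1) (h : IsLagerstromSolution 3 0 ε u)
    (hr : 1 ≤ r) : 1 - u r ≤ 6 * exp 6 * exp (-(ε / 2) * r) := by
  obtain ⟨A, hA⟩ := exists_first_integral h
  have hpos := first_integral_pos h hA
  have hexp : ∀ x, HasDerivAt (fun x => exp (-(ε / 2) * x)) (exp (-(ε / 2) * x) * -(ε / 2)) x :=
    fun x => by simpa using ((hasDerivAt_id x).const_mul (-(ε / 2))).exp
  have hlim : Tendsto (fun x => exp (-(ε / 2) * x)) atTop (𝓝 0) :=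
    tendsto_exp_atBot.comp (tendsto_id.const_mul_atTop_of_neg (by linarith))
  have hkey : 0 ≤ 6 * exp 6 / r * exp (-(ε / 2) * r) - (1 - u r) := by
    refine nonneg_of_hasDerivAt_nonpos (a := 1)
      (f := fun x => 6 * exp 6 / x * exp (-(ε / 2) * x) - (1 - u x))
      (((continuousOn_const.div continuousOn_id fun x hx => (zero_lt_one.trans_le hx).ne').mul
        (by fun_prop)).sub (continuousOn_const.sub h.continuousOn))
      (fun x hx => ((hasDerivAt_const_div (6 * exp 6) (by positivity)).mul (hexp x)).sub
        ((hA x hx).const_sub 1)) (fun x hx => ?_) ?_ hr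
    · have h1 : exp (-ε * ∫ t in (1 : ℝ)..x, u t) ≤ exp 6 * exp (-(ε / 2) * x) := by
        rw [← exp_add, exp_le_exp]
        nlinarith [le_primitive hε hε1 h hx.le]
      have h2 : A / x ^ 2 * exp (-ε * ∫ t in (1 : ℝ)..x, u t)
          ≤ 6 / x ^ 2 * (exp 6 * exp (-(ε / 2) * x)) := by
        have := first_integral_le hε1 h hA
        gcongr
      -- Differentiating the exponential in the majorant only adds a term of the right sign.
      have h3 : 0 ≤ 6 * exp 6 / x * (exp (-(ε / 2) * x) * (ε / 2)) := by positivity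
      have h4 : 6 / x ^ 2 * (exp 6 * exp (-(ε / 2) * x))
        = 6 * exp 6 / x ^ 2 * exp (-(ε / 2) * x) := by ring
      linarith
    · simpa using ((tendsto_const_nhds.div_atTop tendsto_id).mul hlim).sub (tendsto_one_sub h)
  refine (sub_nonneg.1 hkey).trans ?_
  gcongr
  exact div_le_self (by positivity) hr

theorem integrableOn_one_sub (hε : 0 < ε) (hε1 : ε ≤ 1) (h : IsLagerstromSolution 3 0 ε u) :
    IntegrableOn (fun t => 1 - u t) (Ioi 1) := by
  refine Integrable.mono' ((integrableOn_exp_mul_Ioi (a := -(ε / 2)) (by linarith) 1).const_mul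
    (6 * exp 6)) (((continuousOn_const.sub h.continuousOn).mono
      Ioi_subset_Ici_self).aestronglyMeasurable measurableSet_Ioi) ?_
  refine (ae_restrict_iff' measurableSet_Ioi).2 (ae_of_all _ fun t ht => ?_)
  have ht' : 1 ≤ t := le_of_lt ht
  rw [Real.norm_of_nonneg (by linarith [(solution_mem_Icc h ht').2])]
  exact one_sub_le_exp hε hε1 h ht'

/-- The prefactor `ε` cancels the `2 / ε` coming from the decay rate, so the bound does not depend
on `ε`. -/
theorem integral_one_sub_le (hε : 0 < ε) (hε1 : ε ≤ 1) (h : IsLagerstromSolution 3 0 ε u) :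
    ε * ∫ t in Ioi 1, (1 - u t) ≤ 12 * exp 6 := by
  have hneg : -(ε / 2) < 0 := by linarith
  have h1 := setIntegral_mono_on (integrableOn_one_sub hε hε1 h)
    ((integrableOn_exp_mul_Ioi hneg 1).const_mul (6 * exp 6)) measurableSet_Ioi
    fun t ht => one_sub_le_exp hε hε1 h (le_of_lt ht)
  rw [integral_const_mul, integral_exp_mul_Ioi hneg] at h1
  have h2 : exp (-(ε / 2) * 1) ≤ 1 := exp_le_one_iff.2 (by linarith)
  calc ε * ∫ t in Ioi 1, (1 - u t)
      ≤ ε * (6 * exp 6 * (-exp (-(ε / 2) * 1) / -(ε / 2))) := by gcongr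
    _ = 12 * exp 6 * exp (-(ε / 2) * 1) := by field_simp; ring
    _ ≤ 12 * exp 6 := mul_le_of_le_one_right (by positivity) h2

/-- An upper bound for the constant of the first integral, uniform in `0 < ε ≤ 1`. -/
noncomputable def constantBound : ℝ := 6 * exp (1 + 12 * exp 6)

theorem one_le_constantBound : 1 ≤ constantBound := by
  have : 1 ≤ exp (1 + 12 * exp 6) := one_le_exp (by positivity)
  rw [constantBound]
  linarith

theorem exists_constant (hε : 0 < ε) (hε1 : ε ≤ 1) (h : IsLagerstromSolution 3 0 ε u) :
    ∃ C, 0 < C ∧ C ≤ constantBound ∧ IsLagerstromConstant ε u C := by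
  obtain ⟨A, hA⟩ := exists_first_integral h
  have hpos := first_integral_pos h hA
  have hint := integrableOn_one_sub hε hε1 h
  -- Comes from `∫_1^r u = r - 1 - ∫_1^∞ (1 - u) + ∫_r^∞ (1 - u)`.
  refine ⟨A * exp (ε + ε * ∫ t in Ioi 1, (1 - u t)), by positivity, ?_, hint, fun r hr => ?_⟩
  · rw [constantBound]
    have h1 := first_integral_le hε1 h hA
    have h2 := integral_one_sub_le hε hε1 h
    gcongr
  · have h1 := intervalIntegral.integral_Ioi_sub_Ioi hint hr.le
    rw [intervalIntegral.integral_sub intervalIntegrable_const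
      (intervalIntegrable_of_solution h le_rfl hr.le), intervalIntegral.integral_const,
      smul_eq_mul, mul_one] at h1
    have h2 : ∫ t in (1 : ℝ)..r, u t
        = r - 1 - (∫ t in Ioi 1, (1 - u t)) + ∫ t in Ioi r, (1 - u t) := by linarith
    have h0 : r ≠ 0 := by positivity
    rw [(hA r hr).deriv, h2, mul_assoc A, ← exp_add]
    field_simp
    congr 1
    ring

theorem IsLagerstromConstant_unique {C C' : ℝ} (h : IsLagerstromConstant ε u C)
    (h' : IsLagerstromConstant ε u C') : C = C' :=
  mul_right_cancel₀ (exp_ne_zero _) ((h.2 2 one_lt_two).symm.trans (h'.2 2 one_lt_two))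

theorem outerSystem {C : ℝ} (hε : 0 < ε) (h : IsLagerstromSolution 3 0 ε u) (hC : 0 ≤ C)
    (hC' : IsLagerstromConstant ε u C) :
    OuterSystem ε (C * ε) (fun ρ => 1 - u (ρ / ε))
      (fun ρ => ε * ∫ t in Ioi (ρ / ε), (1 - u t)) := by
  have hmaps : MapsTo (fun ρ : ℝ => ρ / ε) (Ici ε) (Ici 1) := fun ρ hρ => (one_le_div hε).2 hρ
  have hcont : ContinuousOn (fun ρ : ℝ => ρ / ε) (Ici ε) := by fun_prop
  have hlim : Tendsto (fun ρ : ℝ => ρ / ε) atTop atTop := tendsto_id.atTop_div_const hε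
  have hder : ∀ ρ, HasDerivAt (fun ρ : ℝ => ρ / ε) (1 / ε) ρ := fun ρ =>
    (hasDerivAt_id ρ).div_const ε
  refine ⟨hε, by positivity, ?_, ?_, fun ρ hρ => ?_, fun ρ hρ => ?_, ?_, ?_⟩
  · exact (continuousOn_const.sub h.continuousOn).comp hcont hmaps
  · exact (hC'.1.continuousOn_Ici_primitive_Ioi.comp hcont hmaps).const_mul ε
  · have h1 : 1 < ρ / ε := (one_lt_div hε).2 hρ
    have h0 : ρ ≠ 0 := (hε.trans hρ).ne'
    refine (((h.differentiableAt _ h1).hasDerivAt.const_sub 1).comp ρ (hder ρ)).congr_deriv ?_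
    have h2 : deriv u (ρ / ε) = C * exp (-ρ) * exp (-(ε * ∫ t in Ioi (ρ / ε), (1 - u t)))
        / (ρ / ε) ^ 2 := by
      rw [eq_div_iff (by positivity), mul_comm, hC'.2 _ h1, mul_assoc, ← exp_add]
      congr 2
      field_simp
      ring
    rw [h2]
    field_simp
  · have h1 : 1 < ρ / ε := (one_lt_div hε).2 hρ
    refine (((hasDerivAt_integral_Ioi hC'.1 ((continuousOn_const.sub h.continuousOn).mono
      Ioi_subset_Ici_self) h1).comp ρ (hder ρ)).const_mul ε).congr_deriv ?_
    field_simp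
  · exact (tendsto_one_sub h).comp hlim
  · simpa using ((tendsto_integral_Ioi_zero hC'.1).comp hlim).const_mul ε

end Solution

theorem abs_mul_le_mul {x y X Y : ℝ} (hx : |x| ≤ X) (hy : |y| ≤ Y) : |x * y| ≤ X * Y := by
  rw [abs_mul]
  exact mul_le_mul hx hy (abs_nonneg _) ((abs_nonneg _).trans hx)

/-! ### Expansions at small argument -/

section SmallArgument

variable {x L : ℝ}

theorem mul_expIntegralE_two_expansion (hx : 0 < x) :
    |x * expIntegralE 2 x - (1 + (x * log x + (eulerMascheroniConstant - 1) * x))| ≤ x ^ 2 := by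
  have h1 := mul_le_mul_of_nonneg_left (neg_eulerMascheroniConstant_le hx) hx.le
  have h2 := mul_le_mul_of_nonneg_left (expIntegralE_one_add_log_le hx) hx.le
  have h3 := add_one_le_exp (-x)
  have h4 := exp_neg_le_quadratic hx.le
  have h5 : x * expIntegralE 2 x = exp (-x) - x * expIntegralE 1 x := by
    rw [expIntegralE_two hx]
    field_simp
  rw [h5, abs_le]
  constructor <;> nlinarith [sq_nonneg x]

theorem sq_mul_outerSecond_expansion (hx : 0 < x) (hL : 1 ≤ L) (hxL : expIntegralE 1 x ≤ L) :
    |x ^ 2 * outerSecond x - -(x * log x + (eulerMascheroniConstant + 2) * x)|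
      ≤ 9 * (x ^ 2 * L) := by
  have h1 := mul_le_mul_of_nonneg_left (neg_eulerMascheroniConstant_le hx) hx.le
  have h2 := mul_le_mul_of_nonneg_left (expIntegralE_one_add_log_le hx) hx.le
  have hE := expIntegralE_nonneg 1 hx
  have h3 : 0 ≤ x * (1 - exp (-x)) * expIntegralE 1 x := by
    have : exp (-x) ≤ 1 := exp_le_one_iff.2 (by linarith)
    exact mul_nonneg (mul_nonneg hx.le (by linarith)) hE
  have h4 : x * (1 - exp (-x)) * expIntegralE 1 x ≤ x * x * L := by
    have := add_one_le_exp (-x)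
    gcongr
    linarith
  have h5 : 0 ≤ x * (1 - exp (-(2 * x))) := by
    have : exp (-(2 * x)) ≤ 1 := exp_le_one_iff.2 (by linarith)
    exact mul_nonneg hx.le (by linarith)
  have h6 : x * (1 - exp (-(2 * x))) ≤ x * (2 * x) := by
    have := add_one_le_exp (-(2 * x))
    gcongr
    linarith
  have h7 : 0 ≤ x ^ 2 * expIntegralE 1 (2 * x) :=
    mul_nonneg (sq_nonneg x) (expIntegralE_nonneg 1 (by positivity))
  have h8 : x ^ 2 * expIntegralE 1 (2 * x) ≤ x ^ 2 * L := by
    have := expIntegralE_anti 1 hx (by linarith : x ≤ 2 * x)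
    gcongr
    linarith
  have h9 : x ^ 2 ≤ x ^ 2 * L := le_mul_of_one_le_right (sq_nonneg x) hL
  have h10 : x ^ 2 * outerSecond x = x * exp (-x) * expIntegralE 1 x - 2 * x * exp (-(2 * x))
      + 4 * (x ^ 2 * expIntegralE 1 (2 * x)) := by
    rw [outerSecond_eq hx]
    field_simp
  rw [h10, abs_le]
  constructor <;> nlinarith

theorem one_le_neg_log (hx : 0 < x) (hx' : x < exp (-1)) : 1 ≤ -log x := by
  have := (log_lt_iff_lt_exp hx).2 hx'
  linarith

theorem mul_neg_log_le_one (hx : 0 < x) : x * -log x ≤ 1 := by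
  have h1 := log_le_sub_one_of_pos (inv_pos.2 hx)
  rw [log_inv] at h1
  have h2 := mul_le_mul_of_nonneg_left h1 hx.le
  rw [mul_sub, mul_inv_cancel₀ hx.ne'] at h2
  linarith

theorem exp_neg_one_lt_half : exp (-1) < 1 / 2 := by
  rw [exp_neg, inv_eq_one_div]
  exact one_div_lt_one_div_of_lt two_pos (by linarith [exp_one_gt_d9])

/-- The correction `-γ + x` is negative, since `x < e^{-1} < 1/2 < γ`. -/
theorem expIntegralE_one_le_neg_log {y : ℝ} (hx : 0 < x) (hx' : x < exp (-1)) (hxy : x ≤ y) :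
    expIntegralE 1 y ≤ -log x := by
  have h1 := expIntegralE_anti 1 hx hxy
  have h2 := expIntegralE_one_add_log_le hx
  linarith [one_half_lt_eulerMascheroniConstant, exp_neg_one_lt_half]

end SmallArgument

/-! ### Expansions of `C` and `u` -/

section Expansion

variable {ε r C : ℝ} {u : ℝ → ℝ}

/-- The comparison bound at `ρ = ε r`. Here `tailE ≤ -log ε` and `ρ E₂(ρ) ≤ 1`, so the cubic error
loses one power of `ε` and gains two logarithms. -/
theorem expansion_of_one_sub (hε : 0 < ε) (hε' : ε < exp (-1)) (h : IsLagerstromSolution 3 0 ε u)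
    (hC : 0 < C) (hCK : C ≤ constantBound) (hC' : IsLagerstromConstant ε u C) (hr : 1 ≤ r) :
    ∃ a b e : ℝ, |a| ≤ r ^ 2 * (ε * -log ε) ^ 2 ∧ |b| ≤ 9 * r ^ 2 * (ε * -log ε) ^ 2 ∧
      |e| ≤ constantBound ^ 3 * (ε * -log ε) ^ 2 ∧
      1 - u r = C / r * (1 + (ε * r * log (ε * r) + (eulerMascheroniConstant - 1) * (ε * r)) + a)
        - (C / r) ^ 2 * (-(ε * r * log (ε * r) + (eulerMascheroniConstant + 2) * (ε * r)) + b)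
        + e := by
  have hr0 : 0 < r := by linarith
  have hx : 0 < ε * r := by positivity
  have hεx : ε ≤ ε * r := le_mul_of_one_le_right hε.le hr
  have hL := one_le_neg_log hε hε'
  have hE := expIntegralE_one_le_neg_log hε hε' hεx
  have hJ0 := tailE_nonneg hx
  have hJ := (tailE_le hx).trans hE
  have hsys := (outerSystem hε h hC.le hC').abs_sub_le hεx
  have hdiv : ε * r / ε = r := by field_simp
  simp only [hdiv] at hsys
  have hE2 : ε * r * expIntegralE 2 (ε * r) ≤ 1 :=
    (mul_expIntegralE_two_le hx).trans (exp_le_one_iff.2 (by linarith))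
  have hE20 := expIntegralE_nonneg 2 hx
  have hLL : -log ε ≤ (-log ε) ^ 2 := by nlinarith
  have h1L : 1 ≤ (-log ε) ^ 2 := hL.trans hLL
  refine ⟨_, _, _, (mul_expIntegralE_two_expansion hx).trans ?_,
    (sq_mul_outerSecond_expansion hx hL hE).trans ?_, hsys.trans ?_, ?_⟩
  · calc (ε * r) ^ 2 = r ^ 2 * ε ^ 2 * 1 := by ring
      _ ≤ r ^ 2 * ε ^ 2 * (-log ε) ^ 2 := by gcongr
      _ = _ := by ring
  · calc 9 * ((ε * r) ^ 2 * -log ε) ≤ 9 * ((ε * r) ^ 2 * (-log ε) ^ 2) := by gcongr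
      _ = _ := by ring
  · calc (C * ε) ^ 3 * (tailE (ε * r) ^ 2 * expIntegralE 2 (ε * r))
        = C ^ 3 * (ε ^ 2 * tailE (ε * r) ^ 2 * (ε * r * expIntegralE 2 (ε * r) / r)) := by
          field_simp
      _ ≤ constantBound ^ 3 * (ε ^ 2 * (-log ε) ^ 2 * 1) := by
          have : ε * r * expIntegralE 2 (ε * r) / r ≤ 1 := by
            rw [div_le_one hr0]
            exact hE2.trans hr
          have : 0 ≤ constantBound ^ 3 := pow_nonneg (hC.le.trans hCK) 3
          gcongr
      _ = _ := by ring
  · field_simp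
    ring

/-- At `r = 1` the expansion reads `1 = C (1 + p + a) - C² (q + b) + e` with `p, q = O(η)`, `η = ε
|log ε|`. The bound on `C` first gives `C = 1 + O(η)`; putting `C = 1` in the terms `C p` and `C² q`
then costs only `O(η²)`, leaving `C = 1 - (p - q) + O(η²)`. -/
theorem constant_estimates (hε : 0 < ε) (hε' : ε < exp (-1)) (h : IsLagerstromSolution 3 0 ε u)
    (hC : 0 < C) (hCK : C ≤ constantBound) (hC' : IsLagerstromConstant ε u C) :
    |C - 1| ≤ 17 * constantBound ^ 3 * (ε * -log ε) ∧
    |C - (1 - 2 * ε * log ε - ε * (2 * eulerMascheroniConstant + 1))|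
      ≤ 200 * constantBound ^ 4 * (ε * -log ε) ^ 2 := by
  obtain ⟨a, b, e, ha, hb, he, heq⟩ := expansion_of_one_sub hε hε' h hC hCK hC' le_rfl
  have hγ := one_half_lt_eulerMascheroniConstant
  have hγ' := eulerMascheroniConstant_lt_two_thirds
  have hL := one_le_neg_log hε hε'
  have hη1 := mul_neg_log_le_one hε
  have hεη : ε ≤ ε * -log ε := le_mul_of_one_le_right hε.le hL
  have hK := one_le_constantBound
  simp only [h.boundary_one, mul_one, div_one, one_pow] at heq ha hb
  set γ := eulerMascheroniConstant
  set K := constantBound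
  obtain ⟨η, hη⟩ : ∃ η, η = ε * -log ε := ⟨_, rfl⟩
  rw [← hη] at ha hb he hη1 hεη ⊢
  have hη0 : 0 ≤ η := hε.le.trans hεη
  have hlog : ε * log ε = -η := by rw [hη]; ring
  obtain ⟨p, hp⟩ : ∃ p, p = ε * log ε + (γ - 1) * ε := ⟨_, rfl⟩
  obtain ⟨q, hq⟩ : ∃ q, q = -(ε * log ε + (γ + 2) * ε) := ⟨_, rfl⟩
  rw [← hp, ← hq] at heq
  have hγε : 1 / 2 * ε ≤ γ * ε := by gcongr
  have hγε' : γ * ε ≤ 2 / 3 * ε := by gcongr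
  have hp' : |p| ≤ 2 * η := by
    rw [hp, hlog, abs_le]
    constructor <;> linarith
  have hq' : |q| ≤ 4 * η := by
    rw [hq, hlog, abs_le]
    constructor <;> linarith
  have hηη : η ^ 2 ≤ η := by nlinarith
  have hCa : |C| ≤ K := by rwa [abs_of_pos hC]
  have hC2 : |C ^ 2| ≤ K ^ 2 := by rw [abs_pow]; gcongr
  have hpa : |p + a| ≤ 3 * η := (abs_add_le _ _).trans (by linarith)
  have hqb : |q + b| ≤ 13 * η := (abs_add_le _ _).trans (by linarith)
  have hK2 : K ^ 2 ≤ K ^ 3 := pow_le_pow_right₀ hK (by norm_num)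
  have hK1 : K ≤ K ^ 3 := le_self_pow₀ hK (by norm_num)
  have hK34 : K ^ 3 ≤ K ^ 4 := pow_le_pow_right₀ hK (by norm_num)
  have hfirst : |C - 1| ≤ 17 * K ^ 3 * η := by
    have h1 := abs_le.1 (abs_mul_le_mul hCa hpa)
    have h2 := abs_le.1 (abs_mul_le_mul hC2 hqb)
    have h3 := abs_le.1 (he.trans (mul_le_mul_of_nonneg_left hηη (by positivity)))
    have h4 := mul_le_mul_of_nonneg_right hK1 hη0
    have h5 := mul_le_mul_of_nonneg_right hK2 hη0
    rw [abs_le]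
    constructor <;> linarith
  refine ⟨hfirst, ?_⟩
  have h1 := abs_le.1 (abs_mul_le_mul hfirst hp')
  have h2 := abs_le.1 (abs_mul_le_mul hCa ha)
  have hC1 : |C + 1| ≤ 2 * K := by
    rw [abs_of_pos (by linarith)]
    linarith
  have h3 := abs_le.1 (abs_mul_le_mul (abs_mul_le_mul hC1 hfirst) hq')
  have h4 := abs_le.1 (abs_mul_le_mul hC2 hb)
  have h5 := abs_le.1 he
  have h6 : C - (1 - 2 * ε * log ε - ε * (2 * γ + 1))
      = -((C - 1) * p) - C * a + (C + 1) * (C - 1) * q + C ^ 2 * b - e := by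
    have : 1 - 2 * ε * log ε - ε * (2 * γ + 1) = 1 - (p - q) := by rw [hp, hq]; ring
    rw [this]
    linear_combination -heq
  have g1 := mul_le_mul_of_nonneg_right (hK1.trans hK34) (sq_nonneg η)
  have g2 := mul_le_mul_of_nonneg_right (hK2.trans hK34) (sq_nonneg η)
  have g3 := mul_le_mul_of_nonneg_right hK34 (sq_nonneg η)
  have g4 : 0 ≤ K ^ 4 * η ^ 2 := by positivity
  rw [h6, abs_le]
  constructor <;> linarith

theorem abs_div_le_of_one_le {y Y : ℝ} (hy : |y| ≤ Y) (hr : 1 ≤ r) : |y / r| ≤ Y := by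
  rw [abs_div, abs_of_pos (zero_lt_one.trans_le hr)]
  exact (div_le_self (abs_nonneg y) hr).trans hy

theorem inner_expansion (hr : 1 ≤ r) : ∃ K : ℝ, ∀ ε : ℝ, 0 < ε → ε < exp (-1) →
    ∀ u : ℝ → ℝ, IsLagerstromSolution 3 0 ε u →
      |u r - (1 - 1 / r - ε * log ε * (1 - 1 / r) - ε * (log r + log r / r)
          + ε * (1 - eulerMascheroniConstant) * (1 - 1 / r))| ≤ K * (ε ^ 2 * log ε ^ 2) := by
  set B := constantBound with hB
  -- Chosen so that `D * η` bounds both first-order terms `p` and `q`.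
  set D := r * (4 + log r) with hD
  refine ⟨200 * B ^ 4 + 17 * B ^ 3 * D + B * r ^ 2 + 2 * B * (17 * B ^ 3) * D + B ^ 2 * (9 * r ^ 2)
    + B ^ 3, fun ε hε hε' u h => ?_⟩
  have hε1 : ε ≤ 1 := by linarith [exp_neg_one_lt_half]
  obtain ⟨C, hC, hCK, hC'⟩ := exists_constant hε hε1 h
  obtain ⟨hC1, hC2⟩ := constant_estimates hε hε' h hC hCK hC'
  obtain ⟨a, b, e, ha, hb, he, heq⟩ := expansion_of_one_sub hε hε' h hC hCK hC' hr
  have hγ := one_half_lt_eulerMascheroniConstant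
  have hγ' := eulerMascheroniConstant_lt_two_thirds
  have hL := one_le_neg_log hε hε'
  have hεη : ε ≤ ε * -log ε := le_mul_of_one_le_right hε.le hL
  have hK := one_le_constantBound
  have hr0 : 0 < r := zero_lt_one.trans_le hr
  have hlr : 0 ≤ log r := log_nonneg hr
  rw [← hB] at hC1 hC2 hCK he hK
  have hηsq : ε ^ 2 * log ε ^ 2 = (ε * -log ε) ^ 2 := by ring
  rw [hηsq]
  rw [log_mul hε.ne' hr0.ne'] at heq
  set γ := eulerMascheroniConstant
  obtain ⟨η, hη⟩ : ∃ η, η = ε * -log ε := ⟨_, rfl⟩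
  rw [← hη] at ha hb he hεη hC1 hC2 ⊢
  have hη0 : 0 ≤ η := hε.le.trans hεη
  have hlog : ε * log ε = -η := by rw [hη]; ring
  obtain ⟨p, hp⟩ : ∃ p, p = ε * r * (log ε + log r) + (γ - 1) * (ε * r) := ⟨_, rfl⟩
  obtain ⟨q, hq⟩ : ∃ q, q = -(ε * r * (log ε + log r) + (γ + 2) * (ε * r)) := ⟨_, rfl⟩
  rw [← hp, ← hq] at heq
  have hεlr : ε * log r ≤ η * log r := by gcongr
  have hεlr0 : 0 ≤ ε * log r := by positivity
  have hγε : 1 / 2 * ε ≤ γ * ε := by gcongr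
  have hγε' : γ * ε ≤ 2 / 3 * ε := by gcongr
  have hp' : |p| ≤ D * η := by
    have : p = r * (-η + ε * log r + (γ - 1) * ε) := by rw [hp, ← hlog]; ring
    rw [this, hD, mul_assoc]
    refine abs_mul_le_mul (abs_of_pos hr0).le (abs_le.2 ?_)
    constructor <;> linarith
  have hq' : |q| ≤ D * η := by
    have : q = r * (η - ε * log r - (γ + 2) * ε) := by rw [hq]; linear_combination (-r) * hlog
    rw [this, hD, mul_assoc]
    refine abs_mul_le_mul (abs_of_pos hr0).le (abs_le.2 ?_)
    constructor <;> linarith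
  have hCa : |C| ≤ B := by rwa [abs_of_pos hC]
  have hCsq : |C ^ 2| ≤ B ^ 2 := by rw [abs_pow]; gcongr
  have hCp : |C + 1| ≤ 2 * B := by
    rw [abs_of_pos (by linarith)]
    linarith
  have h0 := abs_le.1 (abs_div_le_of_one_le hC2 hr)
  have h1 := abs_le.1 (abs_div_le_of_one_le (abs_mul_le_mul hC1 hp') hr)
  have h2 := abs_le.1 (abs_div_le_of_one_le (abs_mul_le_mul hCa ha) hr)
  have hr2 : 1 ≤ r ^ 2 := one_le_pow₀ hr
  have h3 := abs_le.1 (abs_div_le_of_one_le (abs_mul_le_mul (abs_mul_le_mul hCp hC1) hq') hr2)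
  have h4 := abs_le.1 (abs_div_le_of_one_le (abs_mul_le_mul hCsq hb) hr2)
  have h5 := abs_le.1 he
  have h6 : u r - (1 - 1 / r - ε * log ε * (1 - 1 / r) - ε * (log r + log r / r)
          + ε * (1 - γ) * (1 - 1 / r))
      = -((C - (1 - 2 * ε * log ε - ε * (2 * γ + 1))) / r) - (C - 1) * p / r - C * a / r
        + (C + 1) * (C - 1) * q / r ^ 2 + C ^ 2 * b / r ^ 2 - e := by
    have h7 : u r = 1 - (C / r * (1 + p + a) - (C / r) ^ 2 * (q + b) + e) := by
      rw [← heq]; ring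
    rw [h7, hp, hq]
    field_simp
    ring
  rw [h6, abs_le]
  constructor <;> linarith

theorem outer_expansion {ρ : ℝ} (hρ : 0 < ρ) : ∃ K : ℝ, 0 ≤ K ∧ ∀ ε : ℝ, 0 < ε → ε ≤ 1 → ε ≤ ρ →
    ∀ u : ℝ → ℝ, IsLagerstromSolution 3 0 ε u → ∀ C : ℝ, IsLagerstromConstant ε u C →
      |(u (ρ / ε) - 1) - (-(C * ε) * expIntegralE 2 ρ + (C * ε) ^ 2 * outerSecond ρ)|
        ≤ K * ε ^ 3 := by
  have hE := expIntegralE_nonneg 2 hρ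
  have hK := one_le_constantBound
  refine ⟨constantBound ^ 3 * (tailE ρ ^ 2 * expIntegralE 2 ρ), by positivity,
    fun ε hε hε1 hερ u h C hC' => ?_⟩
  obtain ⟨C₀, hC₀, hCK, hC₀'⟩ := exists_constant hε hε1 h
  obtain rfl := IsLagerstromConstant_unique hC' hC₀'
  have h1 := (outerSystem hε h hC₀.le hC').abs_sub_le hερ
  rw [abs_sub_comm] at h1
  calc _ = |C * ε * expIntegralE 2 ρ - (C * ε) ^ 2 * outerSecond ρ - (1 - u (ρ / ε))| := by
        congr 1
        ring
    _ ≤ _ := h1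
    _ = C ^ 3 * (tailE ρ ^ 2 * expIntegralE 2 ρ) * ε ^ 3 := by ring
    _ ≤ _ := by gcongr

/-- In the `E₂` term the error of `C` is multiplied by `ε`; in the quadratic term `C² - 1 = (C +
1)(C - 1)` is `O(ε |log ε|)`, and `|log ε| ≤ log² ε`. -/
theorem outer_expansion_explicit {ρ : ℝ} (hρ : 0 < ρ) : ∃ K : ℝ, ∀ ε : ℝ, 0 < ε →
    ε < exp (-1) → ε ≤ ρ → ∀ u : ℝ → ℝ, IsLagerstromSolution 3 0 ε u →
      |(u (ρ / ε) - 1)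
          - (-ε * (1 - 2 * ε * log ε - ε * (2 * eulerMascheroniConstant + 1)) * expIntegralE 2 ρ
            + ε ^ 2 * outerSecond ρ)| ≤ K * (ε ^ 3 * log ε ^ 2) := by
  obtain ⟨K, hK0, hK⟩ := outer_expansion hρ
  set B := constantBound with hB
  refine ⟨K + 200 * B ^ 4 * expIntegralE 2 ρ + 2 * B * (17 * B ^ 3) * |outerSecond ρ|,
    fun ε hε hε' hερ u h => ?_⟩
  have hε1 : ε ≤ 1 := by linarith [exp_neg_one_lt_half]
  obtain ⟨C, hC, hCK, hC'⟩ := exists_constant hε hε1 h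
  obtain ⟨hC1, hC2⟩ := constant_estimates hε hε' h hC hCK hC'
  have hL := one_le_neg_log hε hε'
  have hB1 := one_le_constantBound
  rw [← hB] at hC1 hC2 hCK hB1
  have hLL : -log ε ≤ log ε ^ 2 := by nlinarith
  have hCp : |C + 1| ≤ 2 * B := by
    rw [abs_of_pos (by linarith)]
    linarith
  have h1 : |(u (ρ / ε) - 1) - (-(C * ε) * expIntegralE 2 ρ + (C * ε) ^ 2 * outerSecond ρ)|
      ≤ K * (ε ^ 3 * log ε ^ 2) := by
    refine (hK ε hε hε1 hερ u h C hC').trans ?_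
    gcongr
    exact le_mul_of_one_le_right (by positivity) (hL.trans hLL)
  have h2 := abs_mul_le_mul (abs_mul_le_mul hC2 (abs_of_pos hε).le)
    (abs_of_nonneg (expIntegralE_nonneg 2 hρ)).le
  have h3 : |(C + 1) * (C - 1) * ε ^ 2 * outerSecond ρ|
      ≤ 2 * B * (17 * B ^ 3) * |outerSecond ρ| * (ε ^ 3 * log ε ^ 2) := by
    refine (abs_mul_le_mul (abs_mul_le_mul (abs_mul_le_mul hCp hC1)
      (abs_of_nonneg (sq_nonneg ε)).le) le_rfl).trans ?_
    calc _ = 2 * B * (17 * B ^ 3) * |outerSecond ρ| * (ε ^ 3 * -log ε) := by ring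
      _ ≤ _ := by gcongr
  have h1' := abs_le.1 h1
  have h2' := abs_le.1 h2
  have h3' := abs_le.1 h3
  rw [abs_le]
  constructor <;> linarith

end Expansion

end Lagerstrom

theorem mainTheorem4 :
    -- existence and expansion of the constant `C`
    (∃ K δ : ℝ, 0 < δ ∧ ∀ ε : ℝ, 0 < ε → ε < δ →
      ∀ u : ℝ → ℝ, IsLagerstromSolution 3 0 ε u →
        ∃ C : ℝ, IsLagerstromConstant ε u C ∧
          |C - (1 - 2 * ε * Real.log ε - ε * (2 * Real.eulerMascheroniConstant + 1))|
            ≤ K * (ε ^ 2 * Real.log ε ^ 2)) ∧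
    -- inner expansion, for fixed `r`
    (∀ r : ℝ, 1 ≤ r → ∃ K δ : ℝ, 0 < δ ∧ ∀ ε : ℝ, 0 < ε → ε < δ →
      ∀ u : ℝ → ℝ, IsLagerstromSolution 3 0 ε u →
        |u r - (1 - 1 / r - ε * Real.log ε * (1 - 1 / r)
            - ε * (Real.log r + Real.log r / r)
            + ε * (1 - Real.eulerMascheroniConstant) * (1 - 1 / r))|
          ≤ K * (ε ^ 2 * Real.log ε ^ 2)) ∧
    -- outer expansion in terms of `C`, for fixed `ρ = ε r`
    (∀ ρ : ℝ, 0 < ρ → ∃ K δ : ℝ, 0 < δ ∧ ∀ ε : ℝ, 0 < ε → ε < δ →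
      ∀ u : ℝ → ℝ, IsLagerstromSolution 3 0 ε u →
        ∀ C : ℝ, IsLagerstromConstant ε u C →
          |(u (ρ / ε) - 1)
              - (-(C * ε) * expIntegralE 2 ρ + (C * ε) ^ 2 * outerSecond ρ)|
            ≤ K * ε ^ 3) ∧
    -- outer expansion, for fixed `ρ = ε r`, with the expansion of `C` inserted
    (∀ ρ : ℝ, 0 < ρ → ∃ K δ : ℝ, 0 < δ ∧ ∀ ε : ℝ, 0 < ε → ε < δ →
      ∀ u : ℝ → ℝ, IsLagerstromSolution 3 0 ε u →
        |(u (ρ / ε) - 1)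
            - (-ε * (1 - 2 * ε * Real.log ε - ε * (2 * Real.eulerMascheroniConstant + 1))
                * expIntegralE 2 ρ + ε ^ 2 * outerSecond ρ)|
          ≤ K * (ε ^ 3 * Real.log ε ^ 2)) := by
  have hδ : 0 < Real.exp (-1) := Real.exp_pos _
  refine ⟨⟨200 * Lagerstrom.constantBound ^ 4, _, hδ, fun ε hε hε' u h => ?_⟩, fun r hr => ?_,
    fun ρ hρ => ?_, fun ρ hρ => ?_⟩
  · have hε1 : ε ≤ 1 := by linarith [Lagerstrom.exp_neg_one_lt_half]
    obtain ⟨C, hC, hCK, hC'⟩ := Lagerstrom.exists_constant hε hε1 h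
    refine ⟨C, hC', (Lagerstrom.constant_estimates hε hε' h hC hCK hC').2.trans_eq ?_⟩
    ring
  · obtain ⟨K, hK⟩ := Lagerstrom.inner_expansion hr
    exact ⟨K, _, hδ, hK⟩
  · obtain ⟨K, -, hK⟩ := Lagerstrom.outer_expansion hρ
    -- Requiring `ε ≤ ρ` places `r = ρ / ε` in the domain `r ≥ 1`.
    exact ⟨K, min 1 ρ, lt_min one_pos hρ, fun ε hε hε' =>
      hK ε hε (hε'.le.trans (min_le_left _ _)) (hε'.le.trans (min_le_right _ _))⟩
  · obtain ⟨K, hK⟩ := Lagerstrom.outer_expansion_explicit hρ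
    exact ⟨K, min (Real.exp (-1)) ρ, lt_min hδ hρ, fun ε hε hε' =>
      hK ε hε (hε'.trans_le (min_le_left _ _)) (hε'.le.trans (min_le_right _ _))⟩
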